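/- Let $n \ge 2$ and $q \ge 2$ be integers, let $d \in \mathbb{Z}$, and let $P(x) := x^n + d$. Let $I \subset \mathbb{R}$ be an interval of length at most $q^{1/n}$. Then the number $W$ of integers $x \in I$ satisfying the congruence $P(x) \equiv 0 \pmod q$ satisfies $W \le n\,\omega(q)$, where $\omega(q)$ denotes the number of distinct prime divisors of $q$. -/

import Mathlib

/-! For each prime p dividing q, `hasResidueClassification_pow_sub` gives the solutions at most n
labels. All differences are divisible by p^e, and those between equal labels by p^(e+w), with v_p(q)
≤ ne + w. Multiplying over p (`sum_agreement_le_log`), Σ w log p ([labels agree] - 1/n) ≤ log|x - y|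
- (log q)/n ≤ 0 for distinct solutions x, y in I.

With more than n ω(q) solutions, linear algebra yields a nonzero weight summing to zero on every
label class. Averaging the same sum over pairs of opposite sign gives a value ≥ 0 by Cauchy–Schwarz
(`sum_agreement_nonneg`). Hence equality holds throughout, which `card_le_of_agreement_nonpos` rules
out. -/

/-! ### Roots of x^n ≡ c modulo a prime power -/

/-- Integers in `S` all agree modulo `p ^ e`, and fall into `n` classes, each lying in one residue
class modulo `p ^ (e + w)`, where `k ≤ n * e + w`. -/
def HasResidueClassification (p n k : ℕ) (S : Set ℤ) : Prop :=
  ∃ (e w : ℕ) (f : ℤ → Fin n), k ≤ n * e + w ∧ ∀ x ∈ S, ∀ y ∈ S,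
    (p : ℤ) ^ e ∣ x - y ∧ (f x = f y → (p : ℤ) ^ (e + w) ∣ x - y)

theorem Finset.exists_injOn_fin {α : Type*} {n : ℕ} (hn : 0 < n) (T : Finset α) (hT : T.card ≤ n) :
    ∃ φ : α → Fin n, Set.InjOn φ T := by
  classical
  obtain ⟨g⟩ := Function.Embedding.nonempty_of_card_le (α := T) (β := Fin n) (by simpa using hT)
  refine ⟨fun a => if h : a ∈ T then g ⟨a, h⟩ else ⟨0, hn⟩, fun a ha b hb hab => ?_⟩
  have ha' : a ∈ T := ha
  have hb' : b ∈ T := hb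
  simp only [ha', hb', dif_pos] at hab
  simpa using g.injective hab

/-- The unit group is cyclic, so ratios of two roots, being n-th roots of unity, take at most n
values. -/
theorem hasResidueClassification_units_of_odd {p : ℕ} (hp : p.Prime) (hp2 : p ≠ 2) {n : ℕ}
    (hn : 0 < n) (k : ℕ) (c : ℤ) :
    HasResidueClassification p n k {x | ¬ (p : ℤ) ∣ x ∧ (p : ℤ) ^ k ∣ x ^ n - c} := by
  classical
  have : NeZero (p ^ k) := ⟨pow_ne_zero _ hp.ne_zero⟩
  have : IsCyclic (ZMod (p ^ k))ˣ := ZMod.isCyclic_units_of_prime_pow p hp hp2 k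
  set S : Set ℤ := {x | ¬ (p : ℤ) ∣ x ∧ (p : ℤ) ^ k ∣ x ^ n - c} with hS
  obtain ⟨φ, hφ⟩ := Finset.exists_injOn_fin hn
    (Finset.univ.filter fun g : (ZMod (p ^ k))ˣ => g ^ n = 1) (IsCyclic.card_pow_eq_one_le hn)
  by_cases hne : S.Nonempty
  swap
  · refine ⟨0, k, fun _ => ⟨0, hn⟩, by simp, fun x hx => (hne ⟨x, hx⟩).elim⟩
  obtain ⟨z, hz⟩ := hne
  have hu : ∀ x ∈ S, ∃ u : (ZMod (p ^ k))ˣ, (u : ZMod (p ^ k)) = (x : ZMod (p ^ k)) := by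
    intro x hx
    have hc : IsCoprime x ((p ^ k : ℕ) : ℤ) := by
      push_cast
      exact (((Nat.prime_iff_prime_int.mp hp).coprime_iff_not_dvd.mpr hx.1).symm).pow_right
    exact (ZMod.coe_int_isUnit_iff_isCoprime x (p ^ k)).mpr hc.symm
  choose! u hu using hu
  have hpow : ∀ x ∈ S, ((u x : (ZMod (p ^ k))ˣ) : ZMod (p ^ k)) ^ n = (c : ZMod (p ^ k)) := by
    intro x hx
    rw [hu x hx, ← Int.cast_pow, ZMod.intCast_eq_intCast_iff_dvd_sub, ← dvd_neg]
    simpa using hx.2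
  have hmem : ∀ x ∈ S, (u x / u z) ^ n = 1 := by
    intro x hx
    rw [div_pow, div_eq_one]
    ext
    push_cast
    rw [hpow x hx, hpow z hz]
  refine ⟨0, k, fun x => φ (u x / u z), by simp, fun x hx y hy => ⟨by simp, fun h => ?_⟩⟩
  have h1 := hφ (by simpa using hmem x hx) (by simpa using hmem y hy) h
  have h2 : u x = u y := by simpa using h1
  have h3 : (y : ZMod (p ^ k)) = x := by rw [← hu x hx, ← hu y hy, h2]
  simpa using (ZMod.intCast_eq_intCast_iff_dvd_sub _ _ _).mp h3

/-- If `x, y ≡ 1 [ZMOD 4]`, then `x ^ m ≡ y ^ m [ZMOD 2 ^ (r + v)]` with `v = v₂(m)`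
forces `x ≡ y [ZMOD 2 ^ r]`. -/
theorem Int.two_pow_dvd_sub_of_dvd_pow_sub_pow {x y : ℤ} {m r v : ℕ}
    (hxy : 4 ∣ x - y) (hx : ¬ 2 ∣ x) (hv : ¬ 2 ^ (v + 1) ∣ m)
    (h : (2 : ℤ) ^ (r + v) ∣ x ^ m - y ^ m) : (2 : ℤ) ^ r ∣ x - y := by
  have h1 := Int.two_pow_sub_pow' m hxy hx
  rw [pow_dvd_iff_le_emultiplicity] at h ⊢
  rw [h1] at h
  have h2 : emultiplicity (2 : ℤ) m < (v + 1 : ℕ) := by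
    rw [emultiplicity_lt_iff_not_dvd]
    exact_mod_cast hv
  generalize emultiplicity (2 : ℤ) m = a at *
  generalize emultiplicity (2 : ℤ) (x - y) = b at *
  cases a with
  | top => simp at h2
  | coe a =>
    cases b with
    | top => simp
    | coe b => norm_cast at *; omega

theorem hasResidueClassification_units_two_of_odd {n : ℕ} (hn : Odd n) (k : ℕ) (c : ℤ) :
    HasResidueClassification 2 n k {x | ¬ ((2 : ℕ) : ℤ) ∣ x ∧ ((2 : ℕ) : ℤ) ^ k ∣ x ^ n - c} := by
  refine ⟨0, k, fun _ => ⟨0, hn.pos⟩, by simp, fun x hx y hy => ⟨by simp, fun _ => ?_⟩⟩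
  obtain ⟨hx1, hx2⟩ := hx
  obtain ⟨hy1, hy2⟩ := hy
  push_cast at *
  have h : (2 : ℤ) ^ k ∣ x ^ n - y ^ n := by simpa using dvd_sub hx2 hy2
  have h2 : ¬ (2 : ℤ) ∣ n := by
    obtain ⟨t, rfl⟩ := hn
    push_cast
    omega
  rw [zero_add, pow_dvd_iff_le_emultiplicity,
    ← emultiplicity_pow_sub_pow_of_prime Int.prime_two (by omega) hx1 h2,
    ← pow_dvd_iff_le_emultiplicity]
  exact h

theorem Int.four_dvd_ite_neg_sub_one {x : ℤ} (hx : ¬ 2 ∣ x) :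
    4 ∣ (if x % 4 = 1 then x else -x) - 1 := by
  split_ifs <;> omega

/-- There can be more than 2m roots modulo 2^k (four for x² ≡ 1 modulo 8), so one works modulo
2^(k-1). The lost factor is recovered from e = 1: all roots are odd. -/
theorem hasResidueClassification_units_two_of_even {m : ℕ} (hm : 0 < m) (k : ℕ) (c : ℤ) :
    HasResidueClassification 2 (2 * m) k
      {x | ¬ ((2 : ℕ) : ℤ) ∣ x ∧ ((2 : ℕ) : ℤ) ^ k ∣ x ^ (2 * m) - c} := by
  rcases Nat.lt_or_ge k 2 with hk | hk
  · refine ⟨1, 0, fun _ => ⟨0, by omega⟩, by omega, fun x hx y hy => ?_⟩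
    obtain ⟨hx1, hx2⟩ := hx
    obtain ⟨hy1, hy2⟩ := hy
    push_cast at *
    omega
  obtain ⟨v, m', hm', rfl⟩ := Nat.exists_eq_two_pow_mul_odd hm.ne'
  set m := 2 ^ v * m' with hmdef
  have hvm : 2 ^ v ≤ m := Nat.le_mul_of_pos_right _ hm'.pos
  have hv : ¬ 2 ^ (v + 1) ∣ m := by
    rw [hmdef, pow_succ, Nat.mul_dvd_mul_iff_left (by positivity)]
    exact hm'.not_two_dvd_nat
  set N : ℤ → ℤ := fun x => if x % 4 = 1 then x else -x with hN
  set r := k - 1 - v with hr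
  have hpos : (0 : ℤ) < 2 ^ v := by positivity
  have hlt : ∀ x : ℤ, (x / 2 ^ r % 2 ^ v).toNat < m := by
    intro x
    have h1 := Int.emod_lt_of_pos (x / 2 ^ r) hpos
    have h2 := Int.emod_nonneg (x / 2 ^ r) hpos.ne'
    have : ((2 ^ v : ℕ) : ℤ) ≤ m := by exact_mod_cast hvm
    push_cast at this
    omega
  -- The label records the sign making x ≡ 1 modulo 4 and the v binary digits of `N x` from position
  -- r on; 2^v ≤ m leaves room for both.
  refine ⟨1, k - 2, fun x => finProdFinEquiv
    (if x % 4 = 1 then 0 else 1, ⟨(N x / 2 ^ r % 2 ^ v).toNat, hlt _⟩), by omega,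
    fun x hx y hy => ?_⟩
  obtain ⟨hx1, hx2⟩ := hx
  obtain ⟨hy1, hy2⟩ := hy
  push_cast at *
  refine ⟨by omega, fun h => ?_⟩
  simp only [EmbeddingLike.apply_eq_iff_eq, Prod.mk.injEq, Fin.mk.injEq] at h
  obtain ⟨hs, hq⟩ := h
  have hq' : N x / 2 ^ r % 2 ^ v = N y / 2 ^ r % 2 ^ v := by
    have h1 := Int.emod_nonneg (N x / 2 ^ r) hpos.ne'
    have h2 := Int.emod_nonneg (N y / 2 ^ r) hpos.ne'
    omega
  have hNx := Int.four_dvd_ite_neg_sub_one hx1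
  have hNy := Int.four_dvd_ite_neg_sub_one hy1
  have hNpow : ∀ z : ℤ, N z ^ (2 * m) = z ^ (2 * m) := by
    intro z
    simp only [hN]
    split_ifs
    · rfl
    · rw [pow_mul, neg_sq, ← pow_mul]
  suffices hmain : (2 : ℤ) ^ (1 + (k - 2)) ∣ N x - N y by
    simp only [hN] at hmain
    by_cases h1 : x % 4 = 1 <;> by_cases h2 : y % 4 = 1 <;> simp [h1, h2] at hs hmain
    · exact hmain
    · rw [← dvd_neg]
      convert! hmain using 1
      ring
  have hx4 : 4 ∣ N x - 1 := hNx
  have hy4 : 4 ∣ N y - 1 := hNy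
  have hxm : 4 ∣ N x ^ m - 1 := hx4.trans (by simpa using sub_dvd_pow_sub_pow (N x) 1 m)
  have hym : 4 ∣ N y ^ m - 1 := hy4.trans (by simpa using sub_dvd_pow_sub_pow (N y) 1 m)
  have h1 : (2 : ℤ) ^ k ∣ N x ^ (2 * m) - N y ^ (2 * m) := by
    rw [hNpow, hNpow]
    simpa using dvd_sub hx2 hy2
  -- The sum factor of the difference of squares is twice an odd number, so it absorbs a single
  -- factor 2.
  obtain ⟨t, ht⟩ : ∃ t, N x ^ m + N y ^ m = 2 * (2 * t + 1) := by
    obtain ⟨a, ha⟩ := hxm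
    obtain ⟨b, hb⟩ := hym
    exact ⟨a + b, by linarith⟩
  have h2 : (2 : ℤ) ^ (k - 1) ∣ N x ^ m - N y ^ m := by
    have h3 : (2 : ℤ) * 2 ^ (k - 1) ∣ 2 * ((2 * t + 1) * (N x ^ m - N y ^ m)) := by
      rw [← pow_succ', Nat.sub_add_cancel (by omega)]
      convert! h1 using 1
      rw [← mul_assoc, ← ht, mul_comm 2 m, pow_mul, pow_mul]
      ring
    have h4 := (mul_dvd_mul_iff_left (two_ne_zero)).mp h3
    refine IsCoprime.dvd_of_dvd_mul_left (IsCoprime.pow_left ?_) h4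
    exact ⟨-t, 1, by ring⟩
  rw [show 1 + (k - 2) = k - 1 by omega]
  have hres : (2 : ℤ) ^ r ∣ N x - N y := by
    rcases Nat.lt_or_ge (k - 1) v with hkv | hkv
    · simp [show r = 0 by omega]
    · refine Int.two_pow_dvd_sub_of_dvd_pow_sub_pow ?_ ?_ hv ?_
      · simpa using dvd_sub hx4 hy4
      · omega
      · rwa [show r + v = k - 1 by omega]
  have hfin : (2 : ℤ) ^ (r + v) ∣ N x - N y := by
    have e1 : N x % 2 ^ r = N y % 2 ^ r := (Int.modEq_iff_dvd.mpr hres).symm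
    have e2 : (2 : ℤ) ^ v ∣ N x / 2 ^ r - N y / 2 ^ r := Int.modEq_iff_dvd.mp hq'.symm
    have e3 := Int.emod_add_mul_ediv (N x) (2 ^ r)
    have e4 := Int.emod_add_mul_ediv (N y) (2 ^ r)
    have e5 : N x - N y = 2 ^ r * (N x / 2 ^ r - N y / 2 ^ r) := by
      rw [mul_sub]; linarith
    rw [e5, pow_add]
    exact mul_dvd_mul_left _ e2
  exact (pow_dvd_pow _ (by omega)).trans hfin

theorem HasResidueClassification.mono {p n k : ℕ} {S T : Set ℤ}
    (h : HasResidueClassification p n k T) (hST : S ⊆ T) : HasResidueClassification p n k S := by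
  obtain ⟨e, w, f, hk, hf⟩ := h
  exact ⟨e, w, f, hk, fun x hx y hy => hf x (hST hx) y (hST hy)⟩

theorem hasResidueClassification_units {p : ℕ} (hp : p.Prime) {n : ℕ} (hn : 0 < n) (k : ℕ)
    (c : ℤ) :
    HasResidueClassification p n k {x | ¬ (p : ℤ) ∣ x ∧ (p : ℤ) ^ k ∣ x ^ n - c} := by
  rcases eq_or_ne p 2 with rfl | hp2
  · rcases Nat.even_or_odd' n with ⟨m, rfl | rfl⟩
    · exact hasResidueClassification_units_two_of_even (by omega) k c
    · exact hasResidueClassification_units_two_of_odd ⟨m, rfl⟩ k c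
  · exact hasResidueClassification_units_of_odd hp hp2 hn k c

/-- When p ∣ c and k > n, dividing the roots by p lowers k by n and e by 1, which preserves k ≤ ne +
w. -/
theorem hasResidueClassification_pow_sub {p : ℕ} (hp : p.Prime) {n : ℕ} (hn : 0 < n) (k : ℕ)
    (c : ℤ) : HasResidueClassification p n k {x | (p : ℤ) ^ k ∣ x ^ n - c} := by
  have hpZ : Prime (p : ℤ) := Nat.prime_iff_prime_int.mp hp
  induction k using Nat.strong_induction_on generalizing c with
  | _ k ih =>
    rcases Nat.eq_zero_or_pos k with rfl | hk
    · exact ⟨0, 0, fun _ => ⟨0, hn⟩, by simp, fun x _ y _ => by simp⟩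
    have hpk : (p : ℤ) ∣ (p : ℤ) ^ k := dvd_pow_self _ hk.ne'
    by_cases hc : (p : ℤ) ∣ c
    swap
    · refine (hasResidueClassification_units hp hn k c).mono fun x hx => ⟨fun hpx => hc ?_, hx⟩
      exact (dvd_sub_right (dvd_pow hpx hn.ne')).mp (hpk.trans hx)
    have hdvd : ∀ x ∈ {x : ℤ | (p : ℤ) ^ k ∣ x ^ n - c}, (p : ℤ) ∣ x := fun x hx =>
      hpZ.dvd_of_dvd_pow ((dvd_sub_left hc).mp (hpk.trans hx))
    rcases Nat.lt_or_ge n k with hnk | hnk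
    swap
    · refine ⟨1, 0, fun _ => ⟨0, hn⟩, by omega, fun x hx y hy => ?_⟩
      have := dvd_sub (hdvd x hx) (hdvd y hy)
      simpa using this
    by_cases hS : {x : ℤ | (p : ℤ) ^ k ∣ x ^ n - c}.Nonempty
    swap
    · exact ⟨0, k, fun _ => ⟨0, hn⟩, by simp, fun x hx => (hS ⟨x, hx⟩).elim⟩
    obtain ⟨z, hz⟩ := hS
    obtain ⟨c', rfl⟩ : (p : ℤ) ^ n ∣ c :=
      (dvd_sub_right (pow_dvd_pow_of_dvd (hdvd z hz) n)).mp ((pow_dvd_pow _ hnk.le).trans hz)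
    obtain ⟨e, w, f, hkew, hf⟩ := ih (k - n) (by omega) c'
    refine ⟨e + 1, w, fun x => f (x / p), by rw [mul_add]; omega, fun x hx y hy => ?_⟩
    have hp0 : (p : ℤ) ≠ 0 := hpZ.ne_zero
    have hred : ∀ t : ℤ, (p : ℤ) ^ k ∣ (p * t) ^ n - p ^ n * c' →
        (p : ℤ) ^ (k - n) ∣ t ^ n - c' := by
      intro t ht
      rw [mul_pow, ← mul_sub, ← Nat.add_sub_cancel' hnk.le, pow_add] at ht
      exact (mul_dvd_mul_iff_left (pow_ne_zero _ hp0)).mp ht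
    obtain ⟨x', rfl⟩ := hdvd x hx
    obtain ⟨y', rfl⟩ := hdvd y hy
    obtain ⟨h1, h2⟩ := hf x' (hred x' hx) y' (hred y' hy)
    dsimp only
    rw [← mul_sub, Int.mul_ediv_cancel_left _ hp0, Int.mul_ediv_cancel_left _ hp0]
    refine ⟨by rw [pow_succ']; exact mul_dvd_mul_left _ h1, fun h => ?_⟩
    rw [show e + 1 + w = e + w + 1 by omega, pow_succ']
    exact mul_dvd_mul_left _ (h2 h)

/-! ### Balanced weights and the Plotkin-type bound -/

open Finset in
/-- A Plotkin-type relation: more than `n * |ι|` words admit a nontrivial signed weighting which is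
balanced on every letter of every coordinate. -/
theorem exists_balanced_weight {ι X : Type*} (P : Finset ι) {n : ℕ}
    (f : ι → X → Fin n) (S : Finset X) (hS : n * #P < #S) :
    ∃ c : X → ℝ, (∃ x ∈ S, c x ≠ 0) ∧ ∀ p ∈ P, ∀ j, ∑ x ∈ S with f p x = j, c x = 0 := by
  classical
  let F : (S → ℝ) →ₗ[ℝ] (P × Fin n → ℝ) :=
    LinearMap.pi fun pj => ∑ x : S, (if f pj.1 x = pj.2 then (1 : ℝ) else 0) • LinearMap.proj x
  have hF : LinearMap.ker F ≠ ⊥ := by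
    apply LinearMap.ker_ne_bot_of_finrank_lt
    simpa [mul_comm] using hS
  obtain ⟨c, hc, hc0⟩ := Submodule.exists_mem_ne_zero_of_ne_bot hF
  refine ⟨fun x => if h : x ∈ S then c ⟨x, h⟩ else 0, ?_, fun p hp j => ?_⟩
  · obtain ⟨x, hx⟩ := Function.ne_iff.mp hc0
    exact ⟨x, x.2, by simpa using hx⟩
  · have h := congrFun (LinearMap.mem_ker.mp hc) (⟨p, hp⟩, j)
    simp only [F, LinearMap.pi_apply, LinearMap.sum_apply, LinearMap.smul_apply,
      LinearMap.proj_apply, smul_eq_mul, ite_mul, one_mul, zero_mul, Pi.zero_apply] at h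
    rw [sum_filter, ← sum_attach]
    simpa [univ_eq_attach] using h

open Finset in
/-- The weighted pairwise agreement, corrected by its mean `1 / n`, is nonnegative on average
between the positive and the negative part of a balanced weighting. -/
theorem sum_agreement_nonneg {ι X : Type*} (P : Finset ι) {n : ℕ} (hn : 0 < n)
    (f : ι → X → Fin n) (l : ι → ℝ) (hl : ∀ p ∈ P, 0 ≤ l p) (S : Finset X) (c : X → ℝ)
    (hc : ∀ p ∈ P, ∀ j, ∑ x ∈ S with f p x = j, c x = 0) :
    0 ≤ ∑ x ∈ S, ∑ y ∈ S, (c x)⁺ * (c y)⁻ *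
      ∑ p ∈ P, l p * ((if f p x = f p y then 1 else 0) - 1 / (n : ℝ)) := by
  have hn' : (0 : ℝ) < n := by exact_mod_cast hn
  have key : ∀ p ∈ P, ∑ x ∈ S, ∑ y ∈ S, (c x)⁺ * (c y)⁻ *
      (l p * ((if f p x = f p y then 1 else 0) - 1 / (n : ℝ))) =
      l p * (∑ j, (∑ x ∈ S with f p x = j, (c x)⁺) ^ 2 - (∑ x ∈ S, (c x)⁺) ^ 2 / n) := by
    intro p hp
    have h1 : ∀ j, ∑ x ∈ S with f p x = j, (c x)⁻ = ∑ x ∈ S with f p x = j, (c x)⁺ := by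
      intro j
      rw [eq_comm, ← sub_eq_zero, ← sum_sub_distrib, ← hc p hp j]
      exact sum_congr rfl fun x _ => posPart_sub_negPart (c x)
    have h2 : ∑ x ∈ S, (c x)⁻ = ∑ x ∈ S, (c x)⁺ := by
      rw [← sum_fiberwise S (f p), ← sum_fiberwise S (f p)]
      exact sum_congr rfl fun j _ => h1 j
    have h3 : ∑ x ∈ S, ∑ y ∈ S, (c x)⁺ * (c y)⁻ * (if f p x = f p y then 1 else 0) =
        ∑ j, (∑ x ∈ S with f p x = j, (c x)⁺) ^ 2 := by
      rw [← sum_fiberwise S (f p)]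
      refine sum_congr rfl fun j _ => ?_
      rw [sq]
      nth_rw 2 [← h1 j]
      rw [sum_mul_sum]
      refine sum_congr rfl fun x hx => ?_
      rw [sum_filter]
      refine sum_congr rfl fun y _ => ?_
      simp only [(mem_filter.mp hx).2, mul_ite, mul_one, mul_zero, eq_comm (a := j)]
    calc _ = ∑ x ∈ S, ∑ y ∈ S, (l p * ((c x)⁺ * (c y)⁻ * (if f p x = f p y then 1 else 0)) -
          l p / n * ((c x)⁺ * (c y)⁻)) :=
          sum_congr rfl fun x _ => sum_congr rfl fun y _ => by ring
      _ = l p * (∑ x ∈ S, ∑ y ∈ S, (c x)⁺ * (c y)⁻ * (if f p x = f p y then 1 else 0)) -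
          l p / n * ((∑ x ∈ S, (c x)⁺) * ∑ y ∈ S, (c y)⁻) := by
          simp only [sum_sub_distrib, ← mul_sum, sum_mul_sum]
      _ = _ := by rw [h3, h2]; ring
  have hswap : ∑ x ∈ S, ∑ y ∈ S, (c x)⁺ * (c y)⁻ *
      ∑ p ∈ P, l p * ((if f p x = f p y then 1 else 0) - 1 / (n : ℝ)) =
      ∑ p ∈ P, ∑ x ∈ S, ∑ y ∈ S, (c x)⁺ * (c y)⁻ *
      (l p * ((if f p x = f p y then 1 else 0) - 1 / (n : ℝ))) := by
    simp only [mul_sum]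
    rw [sum_comm (s := P)]
    exact sum_congr rfl fun x _ => sum_comm
  rw [hswap]
  refine sum_nonneg fun p hp => ?_
  rw [key p hp]
  refine mul_nonneg (hl p hp) (sub_nonneg.mpr ?_)
  -- Cauchy–Schwarz over the n label classes.
  rw [div_le_iff₀ hn', ← sum_fiberwise S (f p)]
  have := sq_sum_le_card_mul_sum_sq (s := (univ : Finset (Fin n)))
    (f := fun j => ∑ x ∈ S with f p x = j, (c x)⁺)
  simpa [mul_comm] using this

theorem card_le_of_agreement_nonpos {ι : Type*} (P : Finset ι) (hP : P.Nonempty) {n : ℕ}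
    (hn : 2 ≤ n) (f : ι → ℤ → Fin n) (l : ι → ℝ) (hl : ∀ p ∈ P, 0 ≤ l p) (S : Finset ℤ) (a b : ℝ)
    (hS : ∀ x ∈ S, (x : ℝ) ∈ Set.Icc a b)
    (hM : ∀ x ∈ S, ∀ y ∈ S, x ≠ y →
      ∑ p ∈ P, l p * ((if f p x = f p y then 1 else 0) - 1 / (n : ℝ)) ≤ 0 ∧
      (∑ p ∈ P, l p * ((if f p x = f p y then 1 else 0) - 1 / (n : ℝ)) = 0 →
        |(x : ℝ) - y| = b - a)) :
    S.card ≤ n * P.card := by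
  by_contra! hcard
  obtain ⟨c, hc0, hc⟩ := exists_balanced_weight P f S hcard
  have hnonneg := sum_agreement_nonneg P (by omega) f l hl S c hc
  set M : ℤ → ℤ → ℝ := fun x y =>
    ∑ p ∈ P, l p * ((if f p x = f p y then 1 else 0) - 1 / (n : ℝ)) with hMdef
  have hterm : ∀ x ∈ S, ∀ y ∈ S, (c x)⁺ * (c y)⁻ * M x y ≤ 0 := by
    intro x hx y hy
    rcases eq_or_ne x y with rfl | hxy
    · rcases le_total (c x) 0 with h | h
      · simp [posPart_eq_zero.mpr h]
      · simp [negPart_eq_zero.mpr h]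
    · exact mul_nonpos_of_nonneg_of_nonpos (mul_nonneg (posPart_nonneg _) (negPart_nonneg _))
        (hM x hx y hy hxy).1
  have hzero : ∀ x ∈ S, ∀ y ∈ S, (c x)⁺ * (c y)⁻ * M x y = 0 := by
    have h1 : ∑ x ∈ S, ∑ y ∈ S, (c x)⁺ * (c y)⁻ * M x y = 0 :=
      le_antisymm (Finset.sum_nonpos fun x hx => Finset.sum_nonpos (hterm x hx)) hnonneg
    intro x hx
    exact (Finset.sum_eq_zero_iff_of_nonpos (hterm x hx)).mp
      ((Finset.sum_eq_zero_iff_of_nonpos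
        (fun x hx => Finset.sum_nonpos (hterm x hx))).mp h1 x hx)
  have hdist : ∀ x ∈ S, ∀ y ∈ S, 0 < c x → c y < 0 → |(x : ℝ) - y| = b - a := by
    intro x hx y hy hcx hcy
    have h1 : (c x)⁺ ≠ 0 := (posPart_pos hcx).ne'
    have h2 : (c y)⁻ ≠ 0 := (negPart_pos hcy).ne'
    have h3 : M x y = 0 := by simpa [h1, h2] using hzero x hx y hy
    exact (hM x hx y hy (by rintro rfl; linarith)).2 h3
  have hsum : ∑ x ∈ S, c x = 0 := by
    obtain ⟨p, hp⟩ := hP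
    rw [← Finset.sum_fiberwise S (f p)]
    exact Finset.sum_eq_zero fun j _ => hc p hp j
  obtain ⟨x₀, hx₀, hcx₀⟩ := Finset.exists_pos_of_sum_zero_of_exists_nonzero c hsum hc0
  obtain ⟨y₀, hy₀, hcy₀⟩ := Finset.exists_pos_of_sum_zero_of_exists_nonzero (fun x => -c x)
    (by rw [Finset.sum_neg_distrib, hsum, neg_zero] : ∑ x ∈ S, -c x = 0) (by simpa using hc0)
  have hcy₀ : c y₀ < 0 := by simpa using hcy₀
  have hne : x₀ ≠ y₀ := by rintro rfl; linarith
  have hd := hdist x₀ hx₀ y₀ hy₀ hcx₀ hcy₀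
  have hpos : 0 < b - a := by
    rw [← hd, abs_pos, sub_ne_zero]
    exact_mod_cast hne
  -- Points at distance b - a are opposite endpoints, so only `x₀` and `y₀` can carry weight.
  have hboth : ∀ z ∈ S, |(z : ℝ) - y₀| = b - a → z = x₀ := by
    intro z hz h
    have h1 := hS x₀ hx₀
    have h2 := hS y₀ hy₀
    have h3 := hS z hz
    rw [Set.mem_Icc] at h1 h2 h3
    have : (z : ℝ) = x₀ := by
      rcases abs_cases ((z : ℝ) - y₀) with h4 | h4 <;>
        rcases abs_cases ((x₀ : ℝ) - y₀) with h5 | h5 <;> linarith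
    exact_mod_cast this
  have hboth' : ∀ z ∈ S, |(x₀ : ℝ) - z| = b - a → z = y₀ := by
    intro z hz h
    have h1 := hS x₀ hx₀
    have h2 := hS y₀ hy₀
    have h3 := hS z hz
    rw [Set.mem_Icc] at h1 h2 h3
    have : (z : ℝ) = y₀ := by
      rcases abs_cases ((x₀ : ℝ) - z) with h4 | h4 <;>
        rcases abs_cases ((x₀ : ℝ) - y₀) with h5 | h5 <;> linarith
    exact_mod_cast this
  -- Otherwise the class of `x₀` would have total weight `c x₀` > 0.
  have hagree : ∀ p ∈ P, f p x₀ = f p y₀ := by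
    intro p hp
    by_contra hfp
    have h := hc p hp (f p x₀)
    have hmem : x₀ ∈ S.filter fun x => f p x = f p x₀ := Finset.mem_filter.mpr ⟨hx₀, rfl⟩
    rw [Finset.sum_eq_single_of_mem x₀ hmem] at h
    · linarith
    intro z hz hzx
    obtain ⟨hzS, hzf⟩ := Finset.mem_filter.mp hz
    rcases lt_trichotomy (c z) 0 with h1 | h1 | h1
    · have := hboth' z hzS (hdist x₀ hx₀ z hzS hcx₀ h1)
      subst this
      exact (hfp hzf.symm).elim
    · exact h1
    · exact (hzx (hboth z hzS (hdist z hzS y₀ hy₀ h1 hcy₀))).elim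
  have hfrac : (0 : ℝ) < 1 - 1 / n := by
    have : (2 : ℝ) ≤ n := by exact_mod_cast hn
    rw [sub_pos, div_lt_one (by linarith)]
    linarith
  have hl0 : ∀ p ∈ P, l p = 0 := by
    have h1 : M x₀ y₀ = 0 := by
      have h1 : (c x₀)⁺ ≠ 0 := (posPart_pos hcx₀).ne'
      have h2 : (c y₀)⁻ ≠ 0 := (negPart_pos hcy₀).ne'
      simpa [h1, h2] using hzero x₀ hx₀ y₀ hy₀
    have h2 : ∑ p ∈ P, l p * (1 - 1 / (n : ℝ)) = 0 := by
      rw [← h1]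
      exact Finset.sum_congr rfl fun p hp => by rw [if_pos (hagree p hp)]
    intro p hp
    have h3 := (Finset.sum_eq_zero_iff_of_nonneg
      (fun p hp => mul_nonneg (hl p hp) hfrac.le)).mp h2 p hp
    exact (mul_eq_zero.mp h3).resolve_right hfrac.ne'
  have hall : ∀ x ∈ S, ∀ y ∈ S, x ≠ y → |(x : ℝ) - y| = b - a := fun x hx y hy hxy =>
    (hM x hx y hy hxy).2 (Finset.sum_eq_zero fun p hp => by rw [hl0 p hp, zero_mul])
  -- All `l p` vanish, so every pair lies at distance b - a; a third point is impossible.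
  have h3 : ({x₀, y₀} : Finset ℤ).card < S.card := by
    rw [Finset.card_pair hne]
    have := hP.card_pos
    nlinarith
  obtain ⟨z, hz, hz'⟩ := Finset.exists_mem_notMem_of_card_lt_card h3
  simp only [Finset.mem_insert, Finset.mem_singleton, not_or] at hz'
  exact hz'.1 (hboth z hz (hall z hz y₀ hy₀ hz'.2))

/-! ### Divisibility of differences and conclusion -/

theorem sum_agreement_le_log {q n : ℕ} (hq : q ≠ 0) (hn : 0 < n) (e w : ℕ → ℕ)
    (f : ℕ → ℤ → Fin n) {x y : ℤ} (hxy : x ≠ y)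
    (h : ∀ p ∈ q.primeFactors, q.factorization p ≤ n * e p + w p ∧ (p : ℤ) ^ e p ∣ x - y ∧
      (f p x = f p y → (p : ℤ) ^ (e p + w p) ∣ x - y)) :
    ∑ p ∈ q.primeFactors, w p * Real.log p * ((if f p x = f p y then 1 else 0) - 1 / (n : ℝ)) ≤
      Real.log |(x : ℝ) - y| - Real.log q / n := by
  have hn' : (0 : ℝ) < n := by exact_mod_cast hn
  have hprime : ∀ p ∈ q.primeFactors, p.Prime := fun p hp => Nat.prime_of_mem_primeFactors hp
  set D : ℕ → ℕ := fun p => p ^ (e p + if f p x = f p y then w p else 0) with hD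
  have hdvd : (∏ p ∈ q.primeFactors, (D p : ℤ)) ∣ x - y := by
    refine Finset.prod_dvd_of_coprime (fun p hp r hr hpr => ?_) fun p hp => ?_
    · exact Nat.isCoprime_iff_coprime.mpr
        (Nat.coprime_pow_primes _ _ (hprime p hp) (hprime r hr) hpr)
    · obtain ⟨-, h1, h2⟩ := h p hp
      simp only [hD]
      push_cast
      split_ifs with hf
      · exact h2 hf
      · simpa using h1
  have hle : (∏ p ∈ q.primeFactors, (D p : ℝ)) ≤ |(x : ℝ) - y| := by
    have := Int.le_of_dvd (abs_pos.mpr (sub_ne_zero.mpr hxy)) ((dvd_abs _ _).mpr hdvd)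
    exact_mod_cast this
  have hD0 : ∀ p ∈ q.primeFactors, (0 : ℝ) < D p := fun p hp => by
    have := (hprime p hp).pos
    simp only [hD]
    positivity
  have hlog := Real.log_le_log (Finset.prod_pos hD0) hle
  rw [Real.log_prod fun p hp => (hD0 p hp).ne'] at hlog
  have hlogq : Real.log q = ∑ p ∈ q.primeFactors, q.factorization p * Real.log p := by
    conv_lhs => rw [← Nat.prod_factorization_pow_eq_self hq]
    rw [Finsupp.prod, Nat.support_factorization]
    push_cast
    rw [Real.log_prod fun p hp => by
      have := (hprime p hp).pos
      positivity]
    simp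
  refine le_trans ?_ (sub_le_sub_right hlog _)
  rw [hlogq, Finset.sum_div, ← Finset.sum_sub_distrib]
  refine Finset.sum_le_sum fun p hp => ?_
  have hlp : 0 ≤ Real.log p := Real.log_natCast_nonneg p
  have hk : (q.factorization p : ℝ) ≤ n * e p + w p := by exact_mod_cast (h p hp).1
  have hk' : q.factorization p * Real.log p / n ≤ (e p + w p / n) * Real.log p := by
    rw [div_le_iff₀ hn']
    calc q.factorization p * Real.log p ≤ (n * e p + w p) * Real.log p :=
          mul_le_mul_of_nonneg_right hk hlp
      _ = _ := by field_simp
  have hDlog : Real.log (D p) =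
      (e p + w p * (if f p x = f p y then 1 else 0)) * Real.log p := by
    simp only [hD]
    push_cast
    rw [Real.log_pow]
    split_ifs <;> simp
  rw [hDlog]
  refine le_trans (le_of_eq ?_) (sub_le_sub_left hk' _)
  ring

theorem theorem4 (n : ℕ) (hn : 2 ≤ n) (d : ℤ) (q : ℕ) (hq : 2 ≤ q) (a b : ℝ)
    (hI : b - a ≤ (q : ℝ) ^ ((1 : ℝ) / (n : ℝ))) :
    {x : ℤ | (x : ℝ) ∈ Set.Icc a b ∧ x ^ n + d ≡ 0 [ZMOD (q : ℤ)]}.encard ≤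
      ((n * ArithmeticFunction.cardDistinctFactors q : ℕ) : ℕ∞) := by
  have hω : ArithmeticFunction.cardDistinctFactors q = q.primeFactors.card := by
    rw [ArithmeticFunction.cardDistinctFactors_apply, Nat.primeFactors, List.card_toFinset]
  rw [hω]
  by_contra! hlt
  obtain ⟨t, hts, htcard⟩ := Set.exists_subset_encard_eq (Order.add_one_le_of_lt hlt)
  have htfin : t.Finite := Set.finite_of_encard_eq_coe (k := n * q.primeFactors.card + 1)
    (by rw [htcard]; push_cast; rfl)
  obtain ⟨S, rfl⟩ := htfin.exists_finset_coe
  have hScard : S.card = n * q.primeFactors.card + 1 := by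
    rw [Set.encard_coe_eq_coe_finsetCard] at htcard
    exact_mod_cast htcard
  have : NeZero n := ⟨by omega⟩
  have hcls : ∀ p ∈ q.primeFactors, HasResidueClassification p n (q.factorization p) S := by
    intro p hp
    refine (hasResidueClassification_pow_sub (Nat.prime_of_mem_primeFactors hp) (by omega) _
      (-d)).mono fun x hx => ?_
    have h1 : (q : ℤ) ∣ x ^ n + d := Int.modEq_zero_iff_dvd.mp (hts hx).2
    have h2 : ((p ^ q.factorization p : ℕ) : ℤ) ∣ q := by exact_mod_cast Nat.ordProj_dvd q p
    push_cast at h2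
    simpa using h2.trans h1
  choose! e w f hew hf using hcls
  have hn0 : (0 : ℝ) < n := by exact_mod_cast (by omega : 0 < n)
  have hq0 : (0 : ℝ) < q := by exact_mod_cast (by omega : 0 < q)
  have hP : q.primeFactors.Nonempty := Nat.nonempty_primeFactors.mpr hq
  have hle := card_le_of_agreement_nonpos q.primeFactors hP hn f (fun p => w p * Real.log p)
    (fun p _ => mul_nonneg (Nat.cast_nonneg _) (Real.log_natCast_nonneg p)) S a b
    (fun x hx => (hts hx).1) fun x hx y hy hxy => ?_
  · omega
  have hM := sum_agreement_le_log (by omega) (by omega) e w f hxy fun p hp =>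
    ⟨hew p hp, hf p hp x hx y hy⟩
  have hx' := (hts hx).1
  have hy' := (hts hy).1
  have hab : |(x : ℝ) - y| ≤ b - a := by
    rw [Set.mem_Icc] at hx' hy'
    rw [abs_le]
    constructor <;> linarith
  have hpos : 0 < |(x : ℝ) - y| := by
    rw [abs_pos, sub_ne_zero]
    exact_mod_cast hxy
  have hlogq : Real.log ((q : ℝ) ^ ((1 : ℝ) / n)) = Real.log q / n := by
    rw [Real.log_rpow hq0]
    ring
  constructor
  · have := Real.log_le_log hpos (hab.trans hI)
    linarith
  -- Equality forces |x - y| ≥ q^(1/n) ≥ b - a.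
  · intro h0
    refine le_antisymm hab (hI.trans ?_)
    rw [← Real.log_le_log_iff (Real.rpow_pos_of_pos hq0 _) hpos]
    linarith
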